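/- Graphs are finite, without loops, and may have parallel edges; $G[S]$ is the subgraph of $G$ induced by $S$; the degree of a vertex is the number of edges incident with it; paths have no repeated vertices. Definitions. Let $H$ be a graph. For disjoint $T',T''\subseteq V(H)$ with $|T'|=|T''|$ and $\eta\ge 1$, a one-to-one flow from $T'$ to $T''$ of congestion at most $\eta$ assigns a non-negative real to every path of $H$ from $T'$ to $T''$ so that every vertex of $T'$ sends, and every vertex of $T''$ receives, exactly one unit of flow, and the total flow on the paths through any edge is at most $\eta$. A one-to-one set of paths from $T'$ to $T''$ is a set of paths such that each path goes from $T'$ to $T''$, and each vertex of $T'$ (of $T''$) is the first (last) vertex of exactly one of them. Let $0<\alpha\le 1$. A set $T\subseteq V(H)$ is $\alpha$-well-linked (resp. node-well-linked) in $H$ if for all disjoint $T',T''\subseteq T$ with $|T'|=|T''|$ there is a one-to-one flow from $T'$ to $T''$ in $H$ of congestion at most $1/\alpha$ (resp. a one-to-one set of mutually node-disjoint paths from $T'$ to $T''$ in $H$). Disjoint sets $T_1,T_2\subseteq V(H)$ are $\alpha$-linked (resp. node-linked) in $H$ if the same holds for all $T'\subseteq T_1$, $T''\subseteq T_2$ with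 $|T'|=|T''|$. A Path-of-Sets System of width $w\ge 0$ and length $\ell\ge 1$ in a graph $G$ consists of pairwise disjoint sets $S_1,\dots,S_\ell\subseteq V(G)$ (clusters) with every $G[S_i]$ connected and non-empty; for each $1\le i\le \ell$, disjoint sets $A_i,B_i\subseteq S_i$ with $|A_i|=|B_i|=w$, where the vertices of $A_1\cup B_\ell$ have degree at most $2$ in $G$; and for each $1\le i<\ell$, a one-to-one set $\mathcal P_i$ of paths in $G$ from $B_i$ to $A_{i+1}$, where all paths in $\bigcup_i\mathcal P_i$ are mutually node-disjoint and have no inner vertex in $\bigcup_j S_j$. The sets $A_1$ and $B_\ell$ are its anchors. The system is $\alpha$-weak if for every $i$ the set $A_i\cup B_i$ is $\alpha$-well-linked in $G[S_i]$; it is good if for every $i$ the set $B_i$ is $1$-well-linked and $(A_i,B_i)$ are $\tfrac12$-linked in $G[S_i]$; it is perfect if for every $i$ each of $A_i$, $B_i$ is node-well-linked and $(A_i,B_i)$ are node-linked in $G[S_i]$. Theorem. There is an absolute constant $c^*>0$ such that the following holds. Let $G$ be a graph of maximum degree at most $3$, let $0<\alpha\le 1$ be such that $1/\alpha$ is an integer,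 and let an $\alpha$-weak Path-of-Sets System of width $w$ and length $\ell$ in $G$ be given, with anchors $A_1,B_\ell$. Then $G$ contains a good Path-of-Sets System of width exactly $\lceil \alpha w/4\rceil$ and length $\ell$, and a perfect Path-of-Sets System of width at least $\alpha w/c^*$ and length $\ell$. Moreover, in each case the anchors $A_1',B_\ell'$ of the new system satisfy $A_1'\subseteq A_1$ and $B_\ell'\subseteq B_\ell$. -/

import Mathlib

/-! Graphs are multigraphs (parallel edges allowed), represented by Mathlib's `Graph V E`.
`G.induce S` is the subgraph `G[S]` induced by the vertex set `S`. -/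

namespace PoS

variable {V : Type*} {E : Type*}

/-- The degree of `v`: the number of edges incident with `v`
(only used for finite graphs without loops). -/
noncomputable def degree (G : Graph V E) (v : V) : ℕ := (G.incidenceSet v).ncard

/-- `IsWalk G x p y`: starting from `x` and traversing successively the pairs (edge, next vertex)
listed in `p`, one walks along edges of `G` and ends in `y`. -/
inductive IsWalk (G : Graph V E) : V → List (E × V) → V → Prop
  | nil {x : V} (hx : x ∈ G.vertexSet) : IsWalk G x [] x
  | cons {e : E} {x y z : V} {p : List (E × V)} (h : G.IsLink e x y) (hp : IsWalk G y p z) :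
      IsWalk G x ((e, y) :: p) z

/-- A path of `G` (no repeated vertices), possibly consisting of a single vertex. -/
structure GPath (G : Graph V E) where
  /-- the first vertex -/
  source : V
  /-- the last vertex -/
  target : V
  /-- the successive pairs (edge, next vertex) -/
  steps : List (E × V)
  isWalk : IsWalk G source steps target
  nodup : (source :: steps.map Prod.snd).Nodup

namespace GPath

variable {G : Graph V E}

/-- The set of vertices of a path, end vertices included. -/
def verts (P : GPath G) : Set V := {v | v ∈ P.source :: P.steps.map Prod.snd}

/-- The set of edges of a path. -/
def edges (P : GPath G) : Set E := {e | e ∈ P.steps.map Prod.fst}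

/-- The inner vertices of a path. -/
def inner (P : GPath G) : Set V := P.verts \ {P.source, P.target}

end GPath

/-- `G` is connected (and has a vertex). -/
def Connected (G : Graph V E) : Prop :=
  G.vertexSet.Nonempty ∧
    ∀ x ∈ G.vertexSet, ∀ y ∈ G.vertexSet, ∃ P : GPath G, P.source = x ∧ P.target = y

/-- `Ps : S → T` (one-to-one): every path of `Ps` starts in `S` and ends in `T`, and every vertex
of `S` (of `T`) is the first (the last) vertex of exactly one path of `Ps`. -/
def OneToOnePaths {G : Graph V E} (Ps : Set (GPath G)) (S T : Set V) : Prop :=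
  Set.BijOn GPath.source Ps S ∧ Set.BijOn GPath.target Ps T

/-- The paths of `Ps` are mutually node-disjoint. -/
def NodeDisjoint {G : Graph V E} (Ps : Set (GPath G)) : Prop :=
  Ps.Pairwise fun P Q => Disjoint P.verts Q.verts

open Classical in
/-- `F : S → T` (one-to-one) with edge-congestion at most `η`: `F` assigns non-negative values to
the paths of `G` from `S` to `T` (and the value `0` to all other paths), every vertex of `S` sends
one flow unit, every vertex of `T` receives one flow unit, and the total flow through any edge is
at most `η`. -/
structure IsOneToOneFlow (G : Graph V E) (η : ℝ) (S T : Set V) (F : GPath G →₀ ℝ) : Prop where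
  nonneg : ∀ P, 0 ≤ F P
  source_mem : ∀ P ∈ F.support, P.source ∈ S
  target_mem : ∀ P ∈ F.support, P.target ∈ T
  sends : ∀ v ∈ S, ∑ P ∈ F.support with P.source = v, F P = 1
  receives : ∀ v ∈ T, ∑ P ∈ F.support with P.target = v, F P = 1
  congestion : ∀ e ∈ G.edgeSet, ∑ P ∈ F.support with e ∈ P.edges, F P ≤ η

/-- `T` is `α`-well-linked in `G`. -/
def WellLinked (G : Graph V E) (α : ℝ) (T : Set V) : Prop :=
  ∀ T' T'' : Finset V, (T' : Set V) ⊆ T → (T'' : Set V) ⊆ T → Disjoint T' T'' →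
    T'.card = T''.card → ∃ F : GPath G →₀ ℝ, IsOneToOneFlow G (1 / α) T' T'' F

/-- `T` is node-well-linked in `G`. -/
def NodeWellLinked (G : Graph V E) (T : Set V) : Prop :=
  ∀ T' T'' : Finset V, (T' : Set V) ⊆ T → (T'' : Set V) ⊆ T → Disjoint T' T'' →
    T'.card = T''.card → ∃ Ps : Set (GPath G), OneToOnePaths Ps T' T'' ∧ NodeDisjoint Ps

/-- The disjoint sets `T₁, T₂` are `α`-linked in `G`. -/
def Linked (G : Graph V E) (α : ℝ) (T₁ T₂ : Set V) : Prop :=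
  ∀ T' T'' : Finset V, (T' : Set V) ⊆ T₁ → (T'' : Set V) ⊆ T₂ →
    T'.card = T''.card → ∃ F : GPath G →₀ ℝ, IsOneToOneFlow G (1 / α) T' T'' F

/-- The disjoint sets `T₁, T₂` are node-linked in `G`. -/
def NodeLinked (G : Graph V E) (T₁ T₂ : Set V) : Prop :=
  ∀ T' T'' : Finset V, (T' : Set V) ⊆ T₁ → (T'' : Set V) ⊆ T₂ →
    T'.card = T''.card → ∃ Ps : Set (GPath G), OneToOnePaths Ps T' T'' ∧ NodeDisjoint Ps

/-- A Path-of-Sets System of width `w` and length `ℓ` in `G`. The clusters are `S 1, …, S ℓ`; the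
values of `S`, `A`, `B` outside `{1, …, ℓ}` and of `Ps` outside `{1, …, ℓ - 1}` play no role. -/
structure PathOfSetsSystem (G : Graph V E) (w ℓ : ℕ) where
  /-- the clusters -/
  S : ℕ → Set V
  A : ℕ → Finset V
  B : ℕ → Finset V
  /-- `Ps i` is the set of paths connecting `B i` to `A (i + 1)` -/
  Ps : ℕ → Set (GPath G)
  one_le_length : 1 ≤ ℓ
  cluster_subset : ∀ i ∈ Set.Icc 1 ℓ, S i ⊆ G.vertexSet
  cluster_disjoint : (Set.Icc 1 ℓ).PairwiseDisjoint S
  cluster_connected : ∀ i ∈ Set.Icc 1 ℓ, Connected (G.induce (S i))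
  A_subset : ∀ i ∈ Set.Icc 1 ℓ, (A i : Set V) ⊆ S i
  B_subset : ∀ i ∈ Set.Icc 1 ℓ, (B i : Set V) ⊆ S i
  A_disjoint_B : ∀ i ∈ Set.Icc 1 ℓ, Disjoint (A i) (B i)
  A_card : ∀ i ∈ Set.Icc 1 ℓ, (A i).card = w
  B_card : ∀ i ∈ Set.Icc 1 ℓ, (B i).card = w
  degree_first : ∀ v ∈ A 1, degree G v ≤ 2
  degree_last : ∀ v ∈ B ℓ, degree G v ≤ 2
  paths : ∀ i ∈ Set.Ico 1 ℓ, OneToOnePaths (Ps i) (B i) (A (i + 1))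
  paths_disjoint : NodeDisjoint (⋃ i ∈ Set.Ico 1 ℓ, Ps i)
  paths_inner : ∀ i ∈ Set.Ico 1 ℓ, ∀ P ∈ Ps i, ∀ j ∈ Set.Icc 1 ℓ, Disjoint P.inner (S j)

namespace PathOfSetsSystem

variable {G : Graph V E} {w ℓ : ℕ}

/-- The system is `α`-weak. -/
def IsWeak (X : PathOfSetsSystem G w ℓ) (α : ℝ) : Prop :=
  ∀ i ∈ Set.Icc 1 ℓ, WellLinked (G.induce (X.S i)) α ((X.A i : Set V) ∪ (X.B i : Set V))

/-- The system is good. -/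
def IsGood (X : PathOfSetsSystem G w ℓ) : Prop :=
  ∀ i ∈ Set.Icc 1 ℓ, WellLinked (G.induce (X.S i)) 1 (X.B i) ∧
    Linked (G.induce (X.S i)) (1 / 2) (X.A i) (X.B i)

/-- The system is perfect. -/
def IsPerfect (X : PathOfSetsSystem G w ℓ) : Prop :=
  ∀ i ∈ Set.Icc 1 ℓ, NodeWellLinked (G.induce (X.S i)) (X.A i) ∧
    NodeWellLinked (G.induce (X.S i)) (X.B i) ∧
    NodeLinked (G.induce (X.S i)) (X.A i) (X.B i)

end PathOfSetsSystem

end PoS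

/-!
A single system serves both claims: the given `α`-weak system contains a perfect one of width
exactly `⌈α w / 4⌉` with the same clusters, whose sets are subsets of the given ones
(`PathOfSetsSystem.IsWeak.exists_isPerfect`). Node-disjoint paths are a flow of congestion one, so
a perfect system is good (`PathOfSetsSystem.IsPerfect.isGood`), and the constant is `4`.

Let `H` be a cluster with its well-linked set `T` of `2w` vertices, and `k = ⌈α w / 4⌉`. Since the
degrees are at most three, a vertex separation of order `s` yields an edge cut of at most `s` edges
(`IsSeparation.exists_edgeCut`). Pushing flow through this cut shows that one side contains at most
`(1 + 1/α) s` vertices of `T`, which is less than a quarter of `T` when `s < k`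
(`WellLinked.isTangleSet`). So the separations of order less than `k` form a tangle, each having a
small side, and this tangle has a matroid: a set `I` is independent if `|I| ≤ k` and
`|I ∩ L| ≤ |L ∩ R|` whenever `L` is the small side of a separation `(L, R)` of order less than `k`.
The rank function `tangleRank` is submodular by uncrossing (`IsTangleSet.isMatroidRank`), and
any two independent sets of the same size are joined by node-disjoint paths in `H`, by Menger's
theorem (`IsTangleSet.exists_disjoint_paths`). A perfect system is therefore obtained as soon as
all the chosen sets are independent in their clusters.

The choices in consecutive clusters interact: the chosen subsets of `B i` and `A (i + 1)` must be
matched by the given paths. Identifying `B i` with `A (i + 1)` along these paths, one looks for a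
common independent set of size `k` of two matroids on `w` elements. In both of them a set `X` has
rank at least `min k (α |X| / 2)` (`WellLinked.le_tangleRank`), so that `r₁ X + r₂ Xᶜ ≥ k` for
every `X`, and the matroid intersection theorem (`IsMatroidRank.exists_common_indep`) applies.
-/

namespace PoS

/-! ### Matroid intersection for rank functions -/

/-- `r` is the rank function of a matroid with finite ground set, given on finite sets. -/
structure IsMatroidRank {ι : Type*} [DecidableEq ι] (r : Finset ι → ℕ) : Prop where
  le_card : ∀ X, r X ≤ X.card
  mono : ∀ ⦃X Y⦄, X ⊆ Y → r X ≤ r Y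
  submodular : ∀ X Y, r (X ∪ Y) + r (X ∩ Y) ≤ r X + r Y

namespace IsMatroidRank

variable {ι κ : Type*} [DecidableEq ι] [DecidableEq κ] {r : Finset ι → ℕ}

lemma union_le (hr : IsMatroidRank r) (X Y : Finset ι) : r (X ∪ Y) ≤ r X + Y.card := by
  have h1 := hr.submodular X Y
  have h2 := hr.le_card Y
  omega

lemma insert_le (hr : IsMatroidRank r) (e : ι) (X : Finset ι) :
    r (insert e X) ≤ r {e} + r X := by
  have h1 := hr.submodular {e} X
  rw [← Finset.insert_eq] at h1
  omega

lemma eq_card_of_subset (hr : IsMatroidRank r) {I J : Finset ι} (hI : r I = I.card)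
    (hJI : J ⊆ I) : r J = J.card := by
  have h1 := hr.union_le J (I \ J)
  rw [Finset.union_sdiff_of_subset hJI, hI, Finset.card_sdiff_of_subset hJI] at h1
  have h2 := hr.le_card J
  have h3 := Finset.card_le_card hJI
  omega

/-- Contraction of an element which is not a loop. -/
lemma contract (hr : IsMatroidRank r) {e : ι} (he : r {e} = 1) :
    IsMatroidRank fun X => r (insert e X) - 1 where
  le_card X := by
    have := hr.insert_le e X
    have := hr.le_card X
    omega
  mono X Y h := Nat.sub_le_sub_right (hr.mono (Finset.insert_subset_insert e h)) 1
  submodular X Y := by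
    have h := hr.submodular (insert e X) (insert e Y)
    rw [← Finset.insert_union_distrib, ← Finset.insert_inter_distrib] at h
    have h1 : ∀ Z, 1 ≤ r (insert e Z) := fun Z =>
      he ▸ hr.mono (Finset.singleton_subset_iff.2 (Finset.mem_insert_self e Z))
    have := h1 X
    have := h1 Y
    have := h1 (X ∪ Y)
    have := h1 (X ∩ Y)
    omega

/-- The matroid on `κ` obtained by pulling back along an injection. -/
lemma comap (hr : IsMatroidRank r) (f : κ ↪ ι) : IsMatroidRank fun X => r (X.map f) where
  le_card X := by simpa using hr.le_card (X.map f)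
  mono X Y h := hr.mono (Finset.map_subset_map.2 h)
  submodular X Y := by
    simpa only [Finset.map_union, Finset.map_inter] using hr.submodular (X.map f) (Y.map f)

/-- **Matroid intersection theorem** (the hard direction): if `r₁ X + r₂ (E \ X) ≥ k` for all
`X ⊆ E`, there is a common independent set of size at least `k`. An element `e` of `E` can be
deleted or contracted: if both operations violate the condition, uncrossing the two violating sets
contradicts it for `E`. -/
theorem exists_common_indep_le (E : Finset ι) : ∀ {r₁ r₂ : Finset ι → ℕ}, IsMatroidRank r₁ →
    IsMatroidRank r₂ → ∀ k : ℕ, (∀ X ⊆ E, k ≤ r₁ X + r₂ (E \ X)) →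
    ∃ I ⊆ E, r₁ I = I.card ∧ r₂ I = I.card ∧ k ≤ I.card := by
  induction E using Finset.induction_on with
  | empty =>
    intro r₁ r₂ h₁ h₂ k hk
    have h := hk ∅ subset_rfl
    have a₁ := h₁.le_card ∅
    have a₂ := h₂.le_card ∅
    simp only [Finset.card_empty, Finset.sdiff_empty] at h a₁ a₂
    exact ⟨∅, subset_rfl, by simp; omega, by simp; omega, by simp; omega⟩
  | insert e E heE ih =>
    intro r₁ r₂ h₁ h₂ k hk
    by_cases hdel : ∀ X ⊆ E, k ≤ r₁ X + r₂ (E \ X)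
    · obtain ⟨I, hI, h⟩ := ih h₁ h₂ k hdel
      exact ⟨I, hI.trans (Finset.subset_insert _ _), h⟩
    push Not at hdel
    obtain ⟨X, hXE, hX⟩ := hdel
    have heX : e ∉ X := fun h => heE (hXE h)
    have e₁ : r₁ {e} = 1 := by
      have a := h₁.le_card {e}
      have b := h₁.insert_le e X
      have c := hk (insert e X) (Finset.insert_subset_insert e hXE)
      rw [Finset.insert_sdiff_insert, Finset.sdiff_insert_of_notMem heE] at c
      rw [Finset.card_singleton] at a
      omega
    have e₂ : r₂ {e} = 1 := by
      have a := h₂.le_card {e}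
      have b := h₂.insert_le e (E \ X)
      have c := hk X (hXE.trans (Finset.subset_insert _ _))
      rw [Finset.insert_sdiff_of_notMem _ heX] at c
      rw [Finset.card_singleton] at a
      omega
    have p₁ : ∀ Z, 1 ≤ r₁ (insert e Z) := fun Z =>
      e₁ ▸ h₁.mono (Finset.singleton_subset_iff.2 (Finset.mem_insert_self e Z))
    have p₂ : ∀ Z, 1 ≤ r₂ (insert e Z) := fun Z =>
      e₂ ▸ h₂.mono (Finset.singleton_subset_iff.2 (Finset.mem_insert_self e Z))
    by_cases hcon : ∀ Y ⊆ E, k - 1 ≤ (r₁ (insert e Y) - 1) + (r₂ (insert e (E \ Y)) - 1)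
    · obtain ⟨I, hI, i₁, i₂, i₃⟩ := ih (h₁.contract e₁) (h₂.contract e₂) (k - 1) hcon
      have hc : (insert e I).card = I.card + 1 := Finset.card_insert_of_notMem fun h => heE (hI h)
      have := p₁ I
      have := p₂ I
      exact ⟨insert e I, Finset.insert_subset_insert e hI, by omega, by omega, by omega⟩
    exfalso
    push Not at hcon
    obtain ⟨Y, hYE, hY⟩ := hcon
    have q₁ := p₁ Y
    have q₂ := p₂ (E \ Y)
    have s₁ := h₁.submodular X (insert e Y)
    have s₂ := h₂.submodular (E \ X) (insert e (E \ Y))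
    have t₁ := hk (X ∪ insert e Y)
      (Finset.union_subset (hXE.trans (Finset.subset_insert _ _))
        (Finset.insert_subset_insert e hYE))
    have t₂ := hk (X ∩ insert e Y)
      (Finset.inter_subset_left.trans (hXE.trans (Finset.subset_insert _ _)))
    have c₁ : insert e E \ (X ∪ insert e Y) = (E \ X) ∩ insert e (E \ Y) := by
      ext v
      by_cases hv : v = e
      · subst hv; simp [heE]
      · simp [hv]; tauto
    have c₂ : insert e E \ (X ∩ insert e Y) = (E \ X) ∪ insert e (E \ Y) := by
      ext v
      by_cases hv : v = e
      · subst hv; simp [heX]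
      · simp [hv]; tauto
    rw [c₁] at t₁
    rw [c₂] at t₂
    omega

theorem exists_common_indep (E : Finset ι) {r₁ r₂ : Finset ι → ℕ} (h₁ : IsMatroidRank r₁)
    (h₂ : IsMatroidRank r₂) (k : ℕ) (hk : ∀ X ⊆ E, k ≤ r₁ X + r₂ (E \ X)) :
    ∃ I ⊆ E, I.card = k ∧ r₁ I = k ∧ r₂ I = k := by
  obtain ⟨I, hI, i₁, i₂, i₃⟩ := exists_common_indep_le E h₁ h₂ k hk
  obtain ⟨J, hJ, rfl⟩ := Finset.exists_subset_card_eq i₃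
  exact ⟨J, hJ.trans hI, rfl, h₁.eq_card_of_subset i₁ hJ, h₂.eq_card_of_subset i₂ hJ⟩

end IsMatroidRank

variable {V E : Type*}

/-! ### Separations and Menger's theorem -/

/-- `(L, R)` is a separation of `H`: together the two sides cover the vertices, and every edge lies
within one of them. Its order is `(L ∩ R).card`. -/
structure IsSeparation [DecidableEq V] (H : Graph V E) (L R : Finset V) : Prop where
  union_eq : ((L ∪ R : Finset V) : Set V) = H.vertexSet
  edge : ∀ ⦃e x y⦄, H.IsLink e x y → (x ∈ L ∧ y ∈ L) ∨ (x ∈ R ∧ y ∈ R)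

namespace IsSeparation

variable [DecidableEq V] {H : Graph V E} {L R L' R' : Finset V}

lemma symm (h : IsSeparation H L R) : IsSeparation H R L :=
  ⟨by rw [Finset.union_comm]; exact h.union_eq, fun _ _ _ he => (h.edge he).symm⟩

lemma mem_or_mem (h : IsSeparation H L R) {v : V} (hv : v ∈ H.vertexSet) : v ∈ L ∨ v ∈ R := by
  rw [← h.union_eq] at hv
  simpa using hv

lemma left_subset (h : IsSeparation H L R) {v : V} (hv : v ∈ L) : v ∈ H.vertexSet := by
  rw [← h.union_eq]
  simp [hv]

lemma union_inter (h : IsSeparation H L R) (h' : IsSeparation H L' R') :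
    IsSeparation H (L ∪ L') (R ∩ R') where
  union_eq := by
    ext v
    constructor
    · intro hv
      simp only [Finset.coe_union, Finset.coe_inter, Set.mem_union, Finset.mem_coe,
        Set.mem_inter_iff] at hv
      rcases hv with (hv | hv) | hv
      · exact h.left_subset hv
      · exact h'.left_subset hv
      · exact h.symm.left_subset hv.1
    · intro hv
      have := h.mem_or_mem hv
      have := h'.mem_or_mem hv
      simp only [Finset.coe_union, Finset.coe_inter, Set.mem_union, Finset.mem_coe,
        Set.mem_inter_iff]
      tauto
  edge e x y he := by
    have := h.edge he
    have := h'.edge he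
    simp only [Finset.mem_union, Finset.mem_inter]
    tauto

lemma inter_union (h : IsSeparation H L R) (h' : IsSeparation H L' R') :
    IsSeparation H (L ∩ L') (R ∪ R') :=
  (h.symm.union_inter h'.symm).symm

end IsSeparation

lemma IsWalk.of_iterate {H : Graph V E} {g : V → V} {ε : V → E} (n : ℕ) :
    ∀ x, x ∈ H.vertexSet → (∀ i < n, H.IsLink (ε (g^[i] x)) (g^[i] x) (g^[i + 1] x)) →
      IsWalk H x ((List.range n).map fun i => (ε (g^[i] x), g^[i + 1] x)) (g^[n] x) := by
  induction n with
  | zero => exact fun x hx _ => IsWalk.nil hx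
  | succ n ih =>
    intro x hx h
    rw [List.range_succ_eq_map, List.map_cons, List.map_map]
    refine IsWalk.cons (h 0 n.succ_pos) ?_
    exact ih (g x) (h 0 n.succ_pos).right_mem fun i hi => h (i + 1) (Nat.succ_lt_succ hi)

/-- Iterating an injection `g` which moves along edges (or fixes vertices) outside `T₂` and whose
range avoids `T₁`, every vertex of `T₁` is eventually carried to `T₂`; the orbits are disjoint
paths. -/
lemma exists_disjoint_paths_of_injOn {H : Graph V E} (hV : H.vertexSet.Finite)
    {T₁ T₂ : Finset V} (hT₁ : (T₁ : Set V) ⊆ H.vertexSet) (hcard : T₁.card = T₂.card)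
    {g : V → V} (hg : ∀ x ∈ H.vertexSet, x ∉ T₂ → g x = x ∨ H.Adj x (g x))
    (hg₁ : ∀ x ∈ H.vertexSet, x ∉ T₂ → g x ∉ T₁)
    (hinj : ∀ x ∈ H.vertexSet, x ∉ T₂ → ∀ y ∈ H.vertexSet, y ∉ T₂ → g x = g y → x = y) :
    ∃ Ps : Set (GPath H), OneToOnePaths Ps T₁ T₂ ∧ NodeDisjoint Ps := by
  classical
  have hmem : ∀ n x, x ∈ H.vertexSet → (∀ i < n, g^[i] x ∉ T₂) → g^[n] x ∈ H.vertexSet := by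
    intro n
    induction n with
    | zero => exact fun x hx _ => hx
    | succ n ih =>
      intro x hx h
      have h1 := ih x hx fun i hi => h i (by omega)
      rw [Function.iterate_succ_apply']
      rcases hg _ h1 (h n (by omega)) with h2 | h2
      · rwa [h2]
      · exact h2.right_mem
  -- orbits of vertices of `T₁` are injective and mutually disjoint up to their arrival in `T₂`
  have hpeel : ∀ i j, ∀ x ∈ T₁, ∀ y ∈ T₁, (∀ a < i, g^[a] x ∉ T₂) → (∀ a < j, g^[a] y ∉ T₂) →
      g^[i] x = g^[j] y → i = j ∧ x = y := by
    intro i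
    induction i with
    | zero =>
      intro j x hx y hy _ hj h
      cases j with
      | zero => exact ⟨rfl, h⟩
      | succ j =>
        rw [Function.iterate_succ_apply'] at h
        refine absurd hx ?_
        rw [show x = g (g^[j] y) from h]
        exact hg₁ _ (hmem j y (hT₁ hy) fun a ha => hj a (by omega)) (hj j (by omega))
    | succ i ih =>
      intro j x hx y hy hi hj h
      have hi' := hmem i x (hT₁ hx) fun a ha => hi a (by omega)
      cases j with
      | zero =>
        rw [Function.iterate_succ_apply'] at h
        refine absurd hy ?_
        rw [show y = g (g^[i] x) from h.symm]
        exact hg₁ _ hi' (hi i (by omega))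
      | succ j =>
        have hj' := hmem j y (hT₁ hy) fun a ha => hj a (by omega)
        rw [Function.iterate_succ_apply', Function.iterate_succ_apply'] at h
        have h1 := hinj _ hi' (hi i (by omega)) _ hj' (hj j (by omega)) h
        obtain ⟨h2, h3⟩ := ih j x hx y hy (fun a ha => hi a (by omega))
          (fun a ha => hj a (by omega)) h1
        exact ⟨by omega, h3⟩
  have harrive : ∀ x ∈ T₁, ∃ n, g^[n] x ∈ T₂ := by
    intro x hx
    by_contra! hno
    have hinj' : Set.InjOn (fun n => g^[n] x) Set.univ := fun i _ j _ h =>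
      (hpeel i j x hx x hx (fun a _ => hno a) (fun a _ => hno a) h).1
    exact Set.infinite_univ
      (Set.Finite.of_injOn (fun n _ => hmem n x (hT₁ hx) fun a _ => hno a) hinj' hV)
  let N : T₁ → ℕ := fun x => Nat.find (harrive x x.2)
  have hN : ∀ x : T₁, g^[N x] x ∈ T₂ := fun x => Nat.find_spec (harrive x x.2)
  have hN' : ∀ x : T₁, ∀ i < N x, g^[i] x ∉ T₂ := fun x i hi => Nat.find_min (harrive x x.2) hi
  have hstep : ∀ x : T₁, ∀ i < N x, H.Adj (g^[i] x) (g^[i + 1] x) := by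
    intro x i hi
    rw [Function.iterate_succ_apply']
    refine (hg _ (hmem i x (hT₁ x.2) fun a ha => hN' x a (by omega)) (hN' x i hi)).resolve_left ?_
    intro h
    have h1 : g^[i + 1] (x : V) = g^[i] (x : V) := by rw [Function.iterate_succ_apply', h]
    have := (hpeel (i + 1) i x x.2 x x.2 (fun a ha => hN' x a (by omega))
      (fun a ha => hN' x a (by omega)) h1).1
    omega
  have hE : ∀ v, ∃ e : Option E, H.Adj v (g v) → ∃ e', e = some e' ∧ H.IsLink e' v (g v) := by
    intro v
    by_cases h : H.Adj v (g v)
    · obtain ⟨e, he⟩ := h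
      exact ⟨some e, fun _ => ⟨e, rfl, he⟩⟩
    · exact ⟨none, fun h' => absurd h' h⟩
  have hP : ∀ x : T₁, ∃ P : GPath H, P.source = x ∧ P.target = g^[N x] x ∧
      ∀ v ∈ P.verts, ∃ i ≤ N x, v = g^[i] x := by
    intro x
    by_cases h0 : N x = 0
    · exact ⟨⟨x, x, [], IsWalk.nil (hT₁ x.2), by simp⟩, rfl, by simp [h0],
        fun v hv => ⟨0, by omega, by simpa [GPath.verts] using hv⟩⟩
    obtain ⟨e₀, -⟩ := hstep x 0 (by omega)
    choose ε' hε' using hE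
    let ε : V → E := fun v => (ε' v).getD e₀
    have hw := IsWalk.of_iterate (H := H) (g := g) (ε := ε) (N x) x (hT₁ x.2) (by
      intro i hi
      have h1 := hstep x i hi
      rw [Function.iterate_succ_apply'] at h1 ⊢
      obtain ⟨e', h2, h3⟩ := hε' _ h1
      simpa [ε, h2] using h3)
    have hverts : (x : V) :: (((List.range (N x)).map
        fun i => (ε (g^[i] (x : V)), g^[i + 1] (x : V))).map Prod.snd) =
        (List.range (N x + 1)).map fun i => g^[i] (x : V) := by
      rw [List.range_succ_eq_map, List.map_cons, List.map_map, List.map_map]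
      rfl
    refine ⟨⟨x, _, _, hw, ?_⟩, rfl, rfl, ?_⟩
    · rw [hverts]
      refine List.Nodup.map_on ?_ List.nodup_range
      intro i hi j hj h
      rw [List.mem_range] at hi hj
      exact (hpeel i j x x.2 x x.2 (fun a ha => hN' x a (by omega))
        (fun a ha => hN' x a (by omega)) h).1
    · intro v hv
      simp only [GPath.verts, hverts, Set.mem_ofPred_eq, List.mem_map, List.mem_range] at hv
      obtain ⟨i, hi, rfl⟩ := hv
      exact ⟨i, by omega, rfl⟩
  choose P hPs hPt hPv using hP
  have htinj : Function.Injective fun x : T₁ => g^[N x] (x : V) := fun x y h =>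
    Subtype.ext (hpeel _ _ x x.2 y y.2 (hN' x) (hN' y) h).2
  refine ⟨Set.range P, ⟨⟨?_, ?_, ?_⟩, ⟨?_, ?_, ?_⟩⟩, ?_⟩
  · rintro _ ⟨x, rfl⟩
    rw [hPs]; exact x.2
  · rintro _ ⟨x, rfl⟩ _ ⟨y, rfl⟩ h
    rw [hPs, hPs] at h
    rw [Subtype.ext h]
  · intro v hv
    exact ⟨P ⟨v, hv⟩, ⟨_, rfl⟩, hPs _⟩
  · rintro _ ⟨x, rfl⟩
    rw [hPt]; exact hN x
  · rintro _ ⟨x, rfl⟩ _ ⟨y, rfl⟩ h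
    rw [hPt, hPt] at h
    rw [htinj h]
  · have himg : Finset.univ.image (fun x : T₁ => g^[N x] (x : V)) = T₂ := by
      refine Finset.eq_of_subset_of_card_le ?_ ?_
      · intro v hv
        obtain ⟨x, -, rfl⟩ := Finset.mem_image.1 hv
        exact hN x
      · rw [Finset.card_image_of_injective _ htinj, Finset.card_univ, Fintype.card_coe, hcard]
    intro v hv
    rw [Finset.mem_coe, ← himg] at hv
    obtain ⟨x, -, rfl⟩ := Finset.mem_image.1 hv
    exact ⟨P x, ⟨x, rfl⟩, hPt x⟩
  · rintro _ ⟨x, rfl⟩ _ ⟨y, rfl⟩ hne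
    rw [Set.disjoint_left]
    intro v hx hy
    obtain ⟨i, hi, rfl⟩ := hPv x v hx
    obtain ⟨j, hj, h⟩ := hPv y _ hy
    have := (hpeel i j x x.2 y y.2 (fun a ha => hN' x a (by omega))
      (fun a ha => hN' y a (by omega)) h).2
    exact hne (by rw [Subtype.ext this])

/-- **Menger's theorem** for sets `T₁, T₂` of the same size. By Hall's theorem there is an
injection from the vertices outside `T₂` to those outside `T₁` mapping every vertex to itself or to
a neighbour: if a set `X` violates Hall's condition, then `N[X] ∪ T₁` and the complement of `X` form
a separation of too small order. -/
theorem exists_disjoint_paths [DecidableEq V] {H : Graph V E} (hV : H.vertexSet.Finite)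
    {T₁ T₂ : Finset V}
    (hT₁ : (T₁ : Set V) ⊆ H.vertexSet) (hT₂ : (T₂ : Set V) ⊆ H.vertexSet)
    (hcard : T₁.card = T₂.card)
    (hsep : ∀ L R, IsSeparation H L R → T₁ ⊆ L → T₂ ⊆ R → T₁.card ≤ (L ∩ R).card) :
    ∃ Ps : Set (GPath H), OneToOnePaths Ps T₁ T₂ ∧ NodeDisjoint Ps := by
  classical
  let U : Finset V := hV.toFinset
  have hU : ∀ v, v ∈ U ↔ v ∈ H.vertexSet := fun v => hV.mem_toFinset
  let t : (U \ T₂ : Finset V) → Finset V := fun x =>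
    {y ∈ U \ T₁ | y = x ∨ H.Adj x y}
  have hall : ∀ s : Finset (U \ T₂ : Finset V), s.card ≤ (s.biUnion t).card := by
    intro s
    let X : Finset V := s.map (Function.Embedding.subtype _)
    have hX : ∀ v ∈ X, v ∈ U ∧ v ∉ T₂ := by
      intro v hv
      obtain ⟨y, -, rfl⟩ := Finset.mem_map.1 hv
      exact ⟨(Finset.mem_sdiff.1 y.2).1, (Finset.mem_sdiff.1 y.2).2⟩
    have hXt : ∀ v, v ∈ s.biUnion t ↔ (v ∈ U ∧ v ∉ T₁) ∧ ∃ x ∈ X, v = x ∨ H.Adj x v := by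
      intro v
      simp only [Finset.mem_biUnion, t, Finset.mem_filter, Finset.mem_sdiff, X, Finset.mem_map]
      constructor
      · rintro ⟨a, ha, h1, h2⟩
        exact ⟨h1, a, ⟨a, ha, rfl⟩, h2⟩
      · rintro ⟨h1, _, ⟨a, ha, rfl⟩, h2⟩
        exact ⟨a, ha, h1, h2⟩
    have hXL : X ⊆ s.biUnion t ∪ T₁ := by
      intro v hv
      rw [Finset.mem_union, hXt]
      by_cases h : v ∈ T₁
      · exact Or.inr h
      · exact Or.inl ⟨⟨(hX v hv).1, h⟩, v, hv, Or.inl rfl⟩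
    have key := hsep (s.biUnion t ∪ T₁) (U \ X) ?_ Finset.subset_union_right ?_
    · have hint : (s.biUnion t ∪ T₁) ∩ (U \ X) = (s.biUnion t ∪ T₁) \ X := by
        ext v
        simp only [Finset.mem_inter, Finset.mem_sdiff, Finset.mem_union]
        constructor
        · exact fun h => ⟨h.1, h.2.2⟩
        · refine fun h => ⟨h.1, ?_, h.2⟩
          rcases h.1 with h1 | h1
          · exact ((hXt v).1 h1).1.1
          · exact (hU v).2 (hT₁ h1)
      have hd : Disjoint (s.biUnion t) T₁ :=
        Finset.disjoint_left.2 fun v hv => ((hXt v).1 hv).1.2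
      rw [hint, Finset.card_sdiff_of_subset hXL, Finset.card_union_of_disjoint hd] at key
      have hXc : X.card = s.card := Finset.card_map _
      have := Finset.card_le_card hXL
      rw [Finset.card_union_of_disjoint hd] at this
      omega
    · have hsub : s.biUnion t ∪ T₁ ⊆ U := by
        intro v hv
        rcases Finset.mem_union.1 hv with h | h
        · exact ((hXt v).1 h).1.1
        · exact (hU v).2 (hT₁ h)
      have hnb : ∀ {x y}, x ∈ X → H.Adj x y → y ∈ s.biUnion t ∪ T₁ := by
        intro x y hx h
        rw [Finset.mem_union, hXt]
        by_cases h' : y ∈ T₁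
        · exact Or.inr h'
        · exact Or.inl ⟨⟨(hU y).2 h.right_mem, h'⟩, x, hx, Or.inr h⟩
      refine ⟨?_, ?_⟩
      · ext v
        rw [Finset.mem_coe, ← hU, Finset.mem_union, Finset.mem_sdiff]
        constructor
        · rintro (h | h)
          · exact hsub h
          · exact h.1
        · intro h
          by_cases h' : v ∈ X
          · exact Or.inl (hXL h')
          · exact Or.inr ⟨h, h'⟩
      · intro e x y he
        by_cases hx : x ∈ X
        · exact Or.inl ⟨hXL hx, hnb hx he.adj⟩
        by_cases hy : y ∈ X
        · exact Or.inl ⟨hnb hy he.symm.adj, hXL hy⟩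
        exact Or.inr ⟨Finset.mem_sdiff.2 ⟨(hU x).2 he.left_mem, hx⟩,
          Finset.mem_sdiff.2 ⟨(hU y).2 he.right_mem, hy⟩⟩
    · intro v hv
      exact Finset.mem_sdiff.2 ⟨(hU v).2 (hT₂ hv), fun h => (hX v h).2 hv⟩
  obtain ⟨f, hf, hft⟩ := (Finset.all_card_le_biUnion_card_iff_exists_injective t).1 hall
  have hmem : ∀ {x}, x ∈ H.vertexSet → x ∉ T₂ → x ∈ U \ T₂ := fun hx hx' =>
    Finset.mem_sdiff.2 ⟨(hU _).2 hx, hx'⟩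
  let g : V → V := fun x => if h : x ∈ U \ T₂ then f ⟨x, h⟩ else x
  have hgf : ∀ {x} (h : x ∈ U \ T₂), g x = f ⟨x, h⟩ := fun h => dif_pos h
  have hft' : ∀ x, f x ∈ U \ T₁ ∧ (f x = x ∨ H.Adj x (f x)) := fun x =>
    Finset.mem_filter.1 (hft x)
  refine exists_disjoint_paths_of_injOn hV hT₁ hcard (g := g) ?_ ?_ ?_
  · intro x hx hx'
    rw [hgf (hmem hx hx')]
    exact (hft' _).2
  · intro x hx hx'
    rw [hgf (hmem hx hx')]
    exact (Finset.mem_sdiff.1 (hft' _).1).2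
  · intro x hx hx' y hy hy' h
    rw [hgf (hmem hx hx'), hgf (hmem hy hy')] at h
    exact congrArg Subtype.val (hf h)

/-! ### Well-linked sets and separations in graphs of maximum degree three -/

/-- The edges of `H` with one end in `P` and one end in `Q`. -/
def edgeCut (H : Graph V E) (P Q : Finset V) : Set E :=
  {e | ∃ x ∈ P, ∃ y ∈ Q, H.IsLink e x y}

lemma IsWalk.exists_mem_edgeCut {H : Graph V E} {P Q : Finset V}
    (hPQ : ∀ v ∈ H.vertexSet, v ∈ P ∨ v ∈ Q) (hd : Disjoint P Q) {x z : V} {p : List (E × V)}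
    (hp : IsWalk H x p z) : x ∈ P → z ∈ Q → ∃ e ∈ p.map Prod.fst, e ∈ edgeCut H P Q := by
  induction hp with
  | nil _ => exact fun h h' => absurd h' (Finset.disjoint_left.1 hd h)
  | @cons e x y z p h hp ih =>
    intro hx hz
    by_cases hy : y ∈ Q
    · exact ⟨e, by simp, x, hx, y, hy, h⟩
    · obtain ⟨e', he', hc⟩ := ih ((hPQ y h.right_mem).resolve_right hy) hz
      exact ⟨e', by simpa using Or.inr (by simpa using he'), hc⟩

/-- A one-to-one flow across a cut uses the capacity of its edges. -/
lemma IsOneToOneFlow.card_le {H : Graph V E} (hE : H.edgeSet.Finite) {P Q : Finset V}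
    (hPQ : ∀ v ∈ H.vertexSet, v ∈ P ∨ v ∈ Q) (hd : Disjoint P Q) {T' T'' : Finset V}
    (hT' : T' ⊆ P) (hT'' : T'' ⊆ Q) {η : ℝ} {F : GPath H →₀ ℝ}
    (hF : IsOneToOneFlow H η T' T'' F) : (T'.card : ℝ) ≤ (edgeCut H P Q).ncard * η := by
  classical
  have hfin : (edgeCut H P Q).Finite := hE.subset fun e ⟨x, _, y, _, h⟩ => h.edge_mem
  have h1 : (T'.card : ℝ) = ∑ p ∈ F.support, F p := by
    rw [← Finset.sum_fiberwise_of_maps_to (g := GPath.source) (t := T')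
      fun p hp => Finset.mem_coe.1 (hF.source_mem p hp), Finset.card_eq_sum_ones, Nat.cast_sum]
    refine Finset.sum_congr rfl fun v hv => ?_
    rw [Nat.cast_one, ← hF.sends v hv]
  have h2 : ∀ p ∈ F.support, F p ≤ ∑ e ∈ hfin.toFinset, if e ∈ p.edges then F p else 0 := by
    intro p hp
    obtain ⟨e, he, hc⟩ := p.isWalk.exists_mem_edgeCut hPQ hd (hT' (hF.source_mem p hp))
      (hT'' (hF.target_mem p hp))
    have he' : e ∈ p.edges := he
    calc F p = if e ∈ p.edges then F p else 0 := by rw [if_pos he']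
      _ ≤ _ := Finset.single_le_sum (f := fun e => if e ∈ p.edges then F p else 0)
        (fun e _ => by split_ifs <;> [exact hF.nonneg p; exact le_rfl])
        (hfin.mem_toFinset.2 hc)
  calc (T'.card : ℝ) = ∑ p ∈ F.support, F p := h1
    _ ≤ ∑ p ∈ F.support, ∑ e ∈ hfin.toFinset, if e ∈ p.edges then F p else 0 :=
      Finset.sum_le_sum h2
    _ = ∑ e ∈ hfin.toFinset, ∑ p ∈ F.support with e ∈ p.edges, F p := by
      rw [Finset.sum_comm]
      exact Finset.sum_congr rfl fun e _ => (Finset.sum_filter _ _).symm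
    _ ≤ ∑ e ∈ hfin.toFinset, η := by
      refine Finset.sum_le_sum fun e he => ?_
      obtain ⟨x, _, y, _, h⟩ := hfin.mem_toFinset.1 he
      convert hF.congestion e h.edge_mem
    _ = (edgeCut H P Q).ncard * η := by
      rw [Finset.sum_const, nsmul_eq_mul, Set.ncard_eq_toFinset_card _ hfin]

/-- In a graph of maximum degree at most three, every separation can be turned into an edge cut of
no more edges: a vertex of `L ∩ R` is put on the side of `R` if it has at least two edges to
`R \ L`, and on the side of `L` otherwise. Every vertex of `L ∩ R` then is responsible for at most
one edge of the cut. -/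
lemma IsSeparation.exists_edgeCut [DecidableEq V] {H : Graph V E} (hE : H.edgeSet.Finite)
    (hdeg : ∀ v ∈ H.vertexSet, degree H v ≤ 3) {L R : Finset V} (h : IsSeparation H L R) :
    ∃ P Q : Finset V, (∀ v ∈ H.vertexSet, v ∈ P ∨ v ∈ Q) ∧ Disjoint P Q ∧ L \ R ⊆ P ∧ R \ L ⊆ Q ∧
      (edgeCut H P Q).ncard ≤ (L ∩ R).card := by
  classical
  let D : V → Set E := fun z => {e | ∃ y ∈ R \ L, H.IsLink e z y}
  have hDfin : ∀ z, (D z).Finite := fun z => hE.subset fun e ⟨_, _, h⟩ => h.edge_mem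
  have hDsub : ∀ z, D z ⊆ H.incidenceSet z := fun z e ⟨_, _, h⟩ => h.inc_left
  have hIfin : ∀ z, (H.incidenceSet z).Finite := fun z =>
    hE.subset (H.incidenceSet_subset_edgeSet z)
  let Q : Finset V := (R \ L) ∪ {z ∈ L ∩ R | 2 ≤ (D z).ncard}
  let P : Finset V := (L \ R) ∪ {z ∈ L ∩ R | ¬ 2 ≤ (D z).ncard}
  have hQ : ∀ v, v ∈ Q ↔ (v ∈ R ∧ v ∉ L) ∨ ((v ∈ L ∧ v ∈ R) ∧ 2 ≤ (D v).ncard) := by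
    intro v; simp [Q]
  have hP : ∀ v, v ∈ P ↔ (v ∈ L ∧ v ∉ R) ∨ ((v ∈ L ∧ v ∈ R) ∧ ¬ 2 ≤ (D v).ncard) := by
    intro v; simp [P]
  -- a cut edge is assigned to its end in `Q` if that lies in `L ∩ R`, and to its end in `P` if not
  have hend : ∀ e : E, ∃ v : Option V, e ∈ edgeCut H P Q → ∃ z ∈ L ∩ R, v = some z ∧
      ((2 ≤ (D z).ncard ∧ e ∈ H.incidenceSet z \ D z) ∨ (¬ 2 ≤ (D z).ncard ∧ e ∈ D z)) := by
    intro e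
    by_cases hc : e ∈ edgeCut H P Q
    swap
    · exact ⟨none, fun h => absurd h hc⟩
    obtain ⟨x, hx, y, hy, hl⟩ := id hc
    rw [hP] at hx
    by_cases hyL : y ∈ L
    · have hy' := ((hQ y).1 hy).resolve_left fun h => h.2 hyL
      refine ⟨some y, fun _ => ⟨y, Finset.mem_inter.2 hy'.1, rfl, Or.inl ⟨hy'.2, hl.inc_right, ?_⟩⟩⟩
      rintro ⟨x', hx', hl'⟩
      rw [Finset.mem_sdiff] at hx'
      obtain rfl := hl.symm.right_unique hl'
      tauto
    · have hy' := ((hQ y).1 hy).resolve_right fun h => hyL h.1.1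
      have hxy := h.edge hl
      have hx' : (x ∈ L ∧ x ∈ R) ∧ ¬ 2 ≤ (D x).ncard := by tauto
      exact ⟨some x, fun _ => ⟨x, Finset.mem_inter.2 hx'.1, rfl,
        Or.inr ⟨hx'.2, y, Finset.mem_sdiff.2 hy', hl⟩⟩⟩
  choose v hv using hend
  refine ⟨P, Q, ?_, ?_, fun x hx => ?_, fun x hx => ?_, ?_⟩
  · intro x hx
    rw [hP, hQ]
    have := h.mem_or_mem hx
    tauto
  · rw [Finset.disjoint_left]
    intro x
    rw [hP, hQ]
    tauto
  · exact Finset.mem_union_left _ hx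
  · exact Finset.mem_union_left _ hx
  · have hinj : Set.InjOn v (edgeCut H P Q) := by
      intro e he e' he' hee
      obtain ⟨z, hz, hvz, hcase⟩ := hv e he
      obtain ⟨z', hz', hvz', hcase'⟩ := hv e' he'
      obtain rfl : z = z' := Option.some_injective _ (by rw [← hvz, ← hvz', hee])
      have hd3 : (H.incidenceSet z).ncard ≤ 3 := hdeg z (h.left_subset (Finset.mem_inter.1 hz).1)
      have hsum := Set.ncard_sdiff_add_ncard_of_subset (hDsub z) (hIfin z)
      by_cases h2 : 2 ≤ (D z).ncard
      · exact (Set.ncard_le_one ((hIfin z).subset Set.sdiff_subset)).1 (by omega) e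
          (hcase.resolve_right fun h => h.1 h2).2 e' (hcase'.resolve_right fun h => h.1 h2).2
      · exact (Set.ncard_le_one (hDfin z)).1 (by omega) e
          (hcase.resolve_left fun h => h2 h.1).2 e' (hcase'.resolve_left fun h => h2 h.1).2
    have hmaps : ∀ e ∈ edgeCut H P Q, v e ∈ (((L ∩ R).map Function.Embedding.some :
        Finset (Option V)) : Set (Option V)) := by
      intro e he
      obtain ⟨z, hz, hvz, -⟩ := hv e he
      rw [hvz]
      simpa using hz
    have := Set.ncard_le_ncard_of_injOn v hmaps hinj (Finset.finite_toSet _)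
    rwa [Set.ncard_coe_finset, Finset.card_map] at this

lemma card_inter_le [DecidableEq V] {T L R P : Finset V} (hLP : L \ R ⊆ P) :
    (T ∩ L).card ≤ (T ∩ P).card + (L ∩ R).card := by
  refine (Finset.card_le_card ?_).trans (Finset.card_union_le _ _)
  intro v hv
  simp only [Finset.mem_inter, Finset.mem_union] at hv ⊢
  by_cases h : v ∈ R
  · exact Or.inr ⟨hv.2, h⟩
  · exact Or.inl ⟨hv.1, hLP (Finset.mem_sdiff.2 ⟨hv.2, h⟩)⟩

/-- One of the sides of a separation contains few vertices of a well-linked set. -/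
lemma WellLinked.card_inter_le_or [DecidableEq V] {H : Graph V E} (hE : H.edgeSet.Finite)
    (hdeg : ∀ v ∈ H.vertexSet, degree H v ≤ 3) {α : ℝ} (hα : 0 < α) {T : Finset V}
    (hT : WellLinked H α T) {L R : Finset V} (h : IsSeparation H L R) :
    α * (T ∩ L).card ≤ (1 + α) * (L ∩ R).card ∨ α * (T ∩ R).card ≤ (1 + α) * (L ∩ R).card := by
  obtain ⟨P, Q, hPQ, hd, hLP, hRQ, hcut⟩ := h.exists_edgeCut hE hdeg
  obtain ⟨T', hT', hT'c⟩ := Finset.exists_subset_card_eq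
    (min_le_left (T ∩ P).card (T ∩ Q).card)
  obtain ⟨T'', hT'', hT''c⟩ := Finset.exists_subset_card_eq
    (min_le_right (T ∩ P).card (T ∩ Q).card)
  have hP := hT'.trans Finset.inter_subset_right
  have hQ := hT''.trans Finset.inter_subset_right
  obtain ⟨F, hF⟩ := hT T' T'' (Finset.coe_subset.2 (hT'.trans Finset.inter_subset_left))
    (Finset.coe_subset.2 (hT''.trans Finset.inter_subset_left))
    (Finset.disjoint_of_subset_left hP (Finset.disjoint_of_subset_right hQ hd))
    (hT'c.trans hT''c.symm)
  have h1 := hF.card_le hE hPQ hd hP hQ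
  have h2 : α * T'.card ≤ (L ∩ R).card := by
    have h3 : ((edgeCut H P Q).ncard : ℝ) ≤ (L ∩ R).card := by exact_mod_cast hcut
    rw [mul_one_div, le_div_iff₀ hα] at h1
    linarith
  have hL := card_inter_le (T := T) hLP
  have hR := card_inter_le (T := T) hRQ
  rw [Finset.inter_comm R L] at hR
  rw [hT'c] at h2
  rcases le_total (T ∩ P).card (T ∩ Q).card with h4 | h4
  · left
    rw [min_eq_left h4] at h2
    have : ((T ∩ L).card : ℝ) ≤ (T ∩ P).card + (L ∩ R).card := by exact_mod_cast hL
    nlinarith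
  · right
    rw [min_eq_right h4] at h2
    have : ((T ∩ R).card : ℝ) ≤ (T ∩ Q).card + (L ∩ R).card := by exact_mod_cast hR
    nlinarith

/-! ### The matroid of a well-linked set -/

/-- `L` is the small side of the separation `(L, R)`, of order less than `k`, with respect to `T`:
it contains at most half of `T`. -/
structure IsSmallSide [DecidableEq V] (H : Graph V E) (T : Finset V) (k : ℕ) (L R : Finset V) :
    Prop where
  isSeparation : IsSeparation H L R
  order_lt : (L ∩ R).card < k
  two_mul_card_le : 2 * (T ∩ L).card ≤ T.card

/-- The separations of `H` of order less than `k` are unbalanced with respect to `T`: one of the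
sides contains less than a quarter of `T`. Hence orienting them towards the other side defines a
tangle. -/
structure IsTangleSet [DecidableEq V] (H : Graph V E) (T : Finset V) (k : ℕ) : Prop where
  finite : H.vertexSet.Finite
  subset : (T : Set V) ⊆ H.vertexSet
  unbalanced : ∀ L R, IsSeparation H L R → (L ∩ R).card < k →
    4 * (T ∩ L).card < T.card ∨ 4 * (T ∩ R).card < T.card

/-- The rank of `X` in the matroid of the tangle of `T`, truncated at `k`: the least number of
vertices separating `X` from the bulk of `T`, where a separator is `L ∩ R` for a small side `L`
together with the vertices of `X` outside `L`. -/
noncomputable def tangleRank [DecidableEq V] (H : Graph V E) (T : Finset V) (k : ℕ)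
    (X : Finset V) : ℕ :=
  sInf {n | n = k ∨ ∃ L R, IsSmallSide H T k L R ∧ n = (L ∩ R).card + (X \ L).card}

section

variable [DecidableEq V] {H : Graph V E} {T : Finset V} {k : ℕ}

lemma tangleRank_le (X : Finset V) : tangleRank H T k X ≤ k :=
  Nat.sInf_le (Or.inl rfl)

lemma IsSmallSide.tangleRank_le {L R : Finset V} (h : IsSmallSide H T k L R) (X : Finset V) :
    tangleRank H T k X ≤ (L ∩ R).card + (X \ L).card :=
  Nat.sInf_le (Or.inr ⟨L, R, h, rfl⟩)

lemma tangleRank_eq (X : Finset V) : tangleRank H T k X = k ∨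
    ∃ L R, IsSmallSide H T k L R ∧ tangleRank H T k X = (L ∩ R).card + (X \ L).card :=
  Nat.sInf_mem (s := {n | n = k ∨ ∃ L R, IsSmallSide H T k L R ∧
    n = (L ∩ R).card + (X \ L).card}) ⟨k, Or.inl rfl⟩

lemma tangleRank_mono {X Y : Finset V} (hXY : X ⊆ Y) :
    tangleRank H T k X ≤ tangleRank H T k Y := by
  rcases tangleRank_eq (H := H) (T := T) (k := k) Y with h | ⟨L, R, h, hY⟩
  · exact (tangleRank_le X).trans h.ge
  · rw [hY]
    have := h.tangleRank_le X
    have := Finset.card_le_card (Finset.sdiff_subset_sdiff hXY (subset_refl L))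
    omega

namespace IsTangleSet

lemma card_le (hT : IsTangleSet H T k) {L R : Finset V} (h : IsSeparation H L R) :
    T.card ≤ (T ∩ L).card + (T ∩ R).card := by
  refine (Finset.card_le_card fun v hv => ?_).trans (Finset.card_union_le _ _)
  have := h.mem_or_mem (hT.subset hv)
  simp only [Finset.mem_union, Finset.mem_inter]
  tauto

lemma four_mul_card_lt (hT : IsTangleSet H T k) {L R : Finset V} (h : IsSmallSide H T k L R) :
    4 * (T ∩ L).card < T.card := by
  have h1 := hT.unbalanced L R h.isSeparation h.order_lt
  have h2 := hT.card_le h.isSeparation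
  have h3 := h.two_mul_card_le
  omega

lemma isSmallSide_or (hT : IsTangleSet H T k) {L R : Finset V} (h : IsSeparation H L R)
    (hk : (L ∩ R).card < k) : IsSmallSide H T k L R ∨ IsSmallSide H T k R L := by
  rcases hT.unbalanced L R h hk with h1 | h1
  · exact Or.inl ⟨h, hk, by omega⟩
  · exact Or.inr ⟨h.symm, by rwa [Finset.inter_comm], by omega⟩

/-- Submodularity of the rank comes from uncrossing two separations. -/
lemma isMatroidRank (hT : IsTangleSet H T k) : IsMatroidRank (tangleRank H T k) where
  le_card X := by
    rcases Nat.eq_zero_or_pos k with rfl | hk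
    · exact (tangleRank_le X).trans (Nat.zero_le _)
    · have h : IsSmallSide H T k ∅ hT.finite.toFinset :=
        ⟨⟨by simp, fun e x y he => Or.inr
          ⟨hT.finite.mem_toFinset.2 he.left_mem, hT.finite.mem_toFinset.2 he.right_mem⟩⟩,
          by simpa using hk, by simp⟩
      simpa using h.tangleRank_le X
  mono _ _ := tangleRank_mono
  submodular X Y := by
    rcases tangleRank_eq (H := H) (T := T) (k := k) X with h | ⟨L, R, h, hX⟩
    · rw [h]
      exact add_le_add (tangleRank_le _) (tangleRank_mono Finset.inter_subset_right)
    rcases tangleRank_eq (H := H) (T := T) (k := k) Y with h' | ⟨L', R', h', hY⟩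
    · rw [h', add_comm _ k]
      exact add_le_add (tangleRank_le _) (tangleRank_mono Finset.inter_subset_left)
    rw [hX, hY]
    have hord : ((L ∪ L') ∩ (R ∩ R')).card + ((L ∩ L') ∩ (R ∪ R')).card ≤
        (L ∩ R).card + (L' ∩ R').card := by
      rw [← Finset.card_union_add_card_inter, ← Finset.card_union_add_card_inter (L ∩ R)]
      refine add_le_add (Finset.card_le_card fun v => ?_) (Finset.card_le_card fun v => ?_) <;>
      · simp only [Finset.mem_union, Finset.mem_inter]
        tauto
    have hout : ((X ∪ Y) \ (L ∪ L')).card + ((X ∩ Y) \ (L ∩ L')).card ≤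
        (X \ L).card + (Y \ L').card := by
      rw [← Finset.card_union_add_card_inter, ← Finset.card_union_add_card_inter (X \ L)]
      refine add_le_add (Finset.card_le_card fun v => ?_) (Finset.card_le_card fun v => ?_) <;>
      · simp only [Finset.mem_union, Finset.mem_inter, Finset.mem_sdiff]
        tauto
    have hunion : tangleRank H T k (X ∪ Y) ≤
        ((L ∪ L') ∩ (R ∩ R')).card + ((X ∪ Y) \ (L ∪ L')).card := by
      by_cases hk : ((L ∪ L') ∩ (R ∩ R')).card < k
      · refine IsSmallSide.tangleRank_le
          ⟨h.isSeparation.union_inter h'.isSeparation, hk, ?_⟩ _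
        have h1 := hT.four_mul_card_lt h
        have h2 := hT.four_mul_card_lt h'
        have h3 := Finset.card_union_le (T ∩ L) (T ∩ L')
        rw [← Finset.inter_union_distrib_left] at h3
        omega
      · exact (tangleRank_le _).trans (by omega)
    have hinter : tangleRank H T k (X ∩ Y) ≤
        ((L ∩ L') ∩ (R ∪ R')).card + ((X ∩ Y) \ (L ∩ L')).card := by
      by_cases hk : ((L ∩ L') ∩ (R ∪ R')).card < k
      · refine IsSmallSide.tangleRank_le
          ⟨h.isSeparation.inter_union h'.isSeparation, hk, ?_⟩ _
        have h1 := h.two_mul_card_le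
        have h2 := Finset.card_le_card
          (Finset.inter_subset_inter (subset_refl T) (Finset.inter_subset_left (s₁ := L) (s₂ := L')))
        omega
      · exact (tangleRank_le _).trans (by omega)
    omega

lemma card_inter_le_of_tangleRank_eq {I L R : Finset V} (hI : tangleRank H T k I = I.card)
    (h : IsSmallSide H T k L R) : (I ∩ L).card ≤ (L ∩ R).card := by
  have h1 := h.tangleRank_le I
  have h2 := Finset.card_inter_add_card_sdiff I L
  omega

/-- Two independent sets of the same size are linked: a separation violating Menger's condition
has a small side, which contains one of the two sets and contradicts its independence. -/
lemma exists_disjoint_paths (hT : IsTangleSet H T k) {I J : Finset V}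
    (hI : tangleRank H T k I = I.card) (hJ : tangleRank H T k J = J.card)
    (hIV : (I : Set V) ⊆ H.vertexSet) (hJV : (J : Set V) ⊆ H.vertexSet) (hIJ : I.card = J.card) :
    ∃ Ps : Set (GPath H), OneToOnePaths Ps I J ∧ NodeDisjoint Ps := by
  refine PoS.exists_disjoint_paths hT.finite hIV hJV hIJ fun L R h hL hR => ?_
  by_cases hk : (L ∩ R).card < k
  · rcases hT.isSmallSide_or h hk with hs | hs
    · simpa [Finset.inter_eq_left.2 hL] using card_inter_le_of_tangleRank_eq hI hs
    · have := card_inter_le_of_tangleRank_eq hJ hs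
      rw [Finset.inter_eq_left.2 hR, Finset.inter_comm] at this
      omega
  · have := tangleRank_le (H := H) (T := T) (k := k) I
    omega

lemma nodeLinked (hT : IsTangleSet H T k) {I J : Finset V}
    (hI : tangleRank H T k I = I.card) (hJ : tangleRank H T k J = J.card)
    (hIV : (I : Set V) ⊆ H.vertexSet) (hJV : (J : Set V) ⊆ H.vertexSet) :
    NodeLinked H I J := fun _ _ hT' hT'' hc =>
  hT.exists_disjoint_paths
    (hT.isMatroidRank.eq_card_of_subset hI (Finset.coe_subset.1 hT'))
    (hT.isMatroidRank.eq_card_of_subset hJ (Finset.coe_subset.1 hT''))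
    (hT'.trans hIV) (hT''.trans hJV) hc

lemma nodeWellLinked (hT : IsTangleSet H T k) {I : Finset V}
    (hI : tangleRank H T k I = I.card) (hIV : (I : Set V) ⊆ H.vertexSet) :
    NodeWellLinked H I := fun T' T'' hT' hT'' _ hc =>
  hT.nodeLinked hI hI hIV hIV T' T'' hT' hT'' hc

end IsTangleSet

namespace WellLinked

lemma isTangleSet (hV : H.vertexSet.Finite) (hE : H.edgeSet.Finite)
    (hdeg : ∀ v ∈ H.vertexSet, degree H v ≤ 3) {α : ℝ} (hα : 0 < α) (hα' : α ≤ 1)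
    (hTV : (T : Set V) ⊆ H.vertexSet) (hT : WellLinked H α T)
    (hk : ∀ s < k, 8 * (s : ℝ) < α * T.card) : IsTangleSet H T k where
  finite := hV
  subset := hTV
  unbalanced L R h hs := by
    have h0 : (0 : ℝ) ≤ (L ∩ R).card := Nat.cast_nonneg _
    have h1 := hk _ hs
    have h2 : ∀ n : ℕ, α * n ≤ (1 + α) * (L ∩ R).card → 4 * n < T.card := by
      intro n hn
      have h3 : α * ((4 * n : ℕ) : ℝ) < α * T.card := by push_cast; nlinarith
      exact_mod_cast lt_of_mul_lt_mul_left h3 hα.le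
    exact (hT.card_inter_le_or hE hdeg hα h).imp (h2 _) (h2 _)

/-- A subset `X` of a well-linked set has rank at least `α |X| / 2`, up to truncation. -/
lemma le_tangleRank (hE : H.edgeSet.Finite)
    (hdeg : ∀ v ∈ H.vertexSet, degree H v ≤ 3) {α : ℝ} (hα : 0 < α) (hα' : α ≤ 1)
    (hT : WellLinked H α T) (hT' : IsTangleSet H T k)
    (hk : ∀ s < k, 8 * (s : ℝ) < α * T.card) {X : Finset V} (hX : X ⊆ T) :
    k ≤ tangleRank H T k X ∨ α * X.card ≤ 2 * tangleRank H T k X := by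
  rcases tangleRank_eq (H := H) (T := T) (k := k) X with h | ⟨L, R, h, hXr⟩
  · exact Or.inl h.ge
  right
  rw [hXr]
  have h0 : (0 : ℝ) ≤ (L ∩ R).card := Nat.cast_nonneg _
  have h1 : α * (T ∩ L).card ≤ 2 * (L ∩ R).card := by
    rcases hT.card_inter_le_or hE hdeg hα h.isSeparation with h2 | h2
    · nlinarith
    · exfalso
      have h3 := hk _ h.order_lt
      have h4 : T.card ≤ 2 * (T ∩ R).card := by
        have := hT'.card_le h.isSeparation
        have := h.two_mul_card_le
        omega
      have h5 : (T.card : ℝ) ≤ 2 * (T ∩ R).card := by exact_mod_cast h4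
      nlinarith
  have h2 : (X.card : ℝ) = (X ∩ L).card + (X \ L).card := by
    exact_mod_cast (Finset.card_inter_add_card_sdiff X L).symm
  have h3 : ((X ∩ L).card : ℝ) ≤ (T ∩ L).card := by
    exact_mod_cast Finset.card_le_card (Finset.inter_subset_inter hX (subset_refl L))
  have h4 : (0 : ℝ) ≤ (X \ L).card := Nat.cast_nonneg _
  push_cast
  nlinarith

end WellLinked

end

/-! ### Node-disjoint paths as flows -/

lemma IsWalk.mem_of_isLink {H : Graph V E} {x z : V} {p : List (E × V)} (hp : IsWalk H x p z)
    {e : E} {a b : V} (h : H.IsLink e a b) :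
    e ∈ p.map Prod.fst → a ∈ x :: p.map Prod.snd := by
  induction hp with
  | nil _ => simp
  | @cons e' x y z p h' hp ih =>
    intro he
    rw [List.map_cons, List.mem_cons] at he
    rcases he with rfl | he
    · rcases h.left_eq_or_eq h' with rfl | rfl <;> simp
    · exact List.mem_cons_of_mem _ (ih he)

lemma OneToOnePaths.exists_flow {H : Graph V E} {Ps : Set (GPath H)} {T' T'' : Finset V}
    (h : OneToOnePaths Ps T' T'') (hd : NodeDisjoint Ps) {η : ℝ} (hη : 1 ≤ η) :
    ∃ F : GPath H →₀ ℝ, IsOneToOneFlow H η T' T'' F := by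
  classical
  have hfin : Ps.Finite := Set.Finite.of_injOn h.1.mapsTo h.1.injOn T'.finite_toSet
  let F : GPath H →₀ ℝ := Finsupp.indicator hfin.toFinset fun _ _ => 1
  have hF : ∀ P ∈ Ps, F P = 1 := fun P hP =>
    Finsupp.indicator_of_mem (hfin.mem_toFinset.2 hP) _
  have hF' : ∀ P ∉ Ps, F P = 0 := fun P hP =>
    Finsupp.indicator_of_notMem (fun h' => hP (hfin.mem_toFinset.1 h')) _
  have hsupp : ∀ P, P ∈ F.support ↔ P ∈ Ps := by
    intro P
    rw [Finsupp.mem_support_iff]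
    by_cases hP : P ∈ Ps
    · simp [hP, hF P hP]
    · simp [hP, hF' P hP]
  have hunique : ∀ (f : GPath H → V) (T : Finset V), Set.BijOn f Ps T → ∀ v ∈ T,
      ∑ P ∈ F.support with f P = v, F P = 1 := by
    intro f T hf v hv
    obtain ⟨P, hP, rfl⟩ := hf.surjOn hv
    have : {Q ∈ F.support | f Q = f P} = {P} := by
      ext Q
      simp only [Finset.mem_filter, hsupp, Finset.mem_singleton]
      exact ⟨fun hQ => hf.injOn hQ.1 hP hQ.2, by rintro rfl; exact ⟨hP, rfl⟩⟩
    rw [this, Finset.sum_singleton, hF P hP]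
  refine ⟨F, ⟨fun P => ?_, fun P hP => h.1.mapsTo ((hsupp P).1 hP),
    fun P hP => h.2.mapsTo ((hsupp P).1 hP), fun v hv => ?_, fun v hv => ?_, fun e he => ?_⟩⟩
  · by_cases hP : P ∈ Ps
    · rw [hF P hP]; exact zero_le_one
    · rw [hF' P hP]
  · convert hunique _ _ h.1 v hv
  · convert hunique _ _ h.2 v hv
  · refine le_trans ?_ hη
    obtain ⟨a, b, hab⟩ := H.exists_isLink_of_mem_edgeSet he
    have hcard : ({P ∈ F.support | e ∈ P.edges} : Finset (GPath H)).card ≤ 1 := by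
      rw [Finset.card_le_one]
      intro P hP Q hQ
      rw [Finset.mem_filter, hsupp] at hP hQ
      by_contra hne
      exact Set.disjoint_left.1 (hd hP.1 hQ.1 hne)
        (P.isWalk.mem_of_isLink hab hP.2) (Q.isWalk.mem_of_isLink hab hQ.2)
    calc _ = ∑ P ∈ F.support with e ∈ P.edges, (1 : ℝ) :=
          Finset.sum_congr (by ext; simp) fun P hP =>
            hF P ((hsupp P).1 (Finset.mem_filter.1 hP).1)
      _ ≤ 1 := by
        rw [Finset.sum_const, nsmul_one]
        exact_mod_cast hcard

/-! ### Path-of-Sets Systems -/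

lemma degree_induce_le {G : Graph V E} (hE : G.edgeSet.Finite) (S : Set V) (v : V) :
    degree (G.induce S) v ≤ degree G v := by
  refine Set.ncard_le_ncard ?_ (hE.subset (G.incidenceSet_subset_edgeSet v))
  rintro e ⟨y, h⟩
  exact ⟨y, h.1⟩

namespace PathOfSetsSystem

variable {G : Graph V E} {w k ℓ : ℕ}

lemma IsPerfect.isGood {X : PathOfSetsSystem G w ℓ} (h : X.IsPerfect) : X.IsGood := by
  intro i hi
  obtain ⟨-, h1, h2⟩ := h i hi
  refine ⟨fun T' T'' hT' hT'' hd hc => ?_, fun T' T'' hT' hT'' hc => ?_⟩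
  · obtain ⟨Ps, h3, h4⟩ := h1 T' T'' hT' hT'' hd hc
    exact h3.exists_flow h4 (by norm_num)
  · obtain ⟨Ps, h3, h4⟩ := h2 T' T'' hT' hT'' hc
    exact h3.exists_flow h4 (by norm_num)

/-- The subsystem with the same clusters and smaller sets `A' i`, `B' i`, matched by the paths
starting in `B' i`. -/
def restrict (X : PathOfSetsSystem G w ℓ) (A' B' : ℕ → Finset V)
    (hA : ∀ i ∈ Set.Icc 1 ℓ, A' i ⊆ X.A i ∧ (A' i).card = k)
    (hB : ∀ i ∈ Set.Icc 1 ℓ, B' i ⊆ X.B i ∧ (B' i).card = k)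
    (hP : ∀ i ∈ Set.Ico 1 ℓ,
      OneToOnePaths {P | P ∈ X.Ps i ∧ P.source ∈ B' i} (B' i) (A' (i + 1))) :
    PathOfSetsSystem G k ℓ where
  S := X.S
  A := A'
  B := B'
  Ps i := {P | P ∈ X.Ps i ∧ P.source ∈ B' i}
  one_le_length := X.one_le_length
  cluster_subset := X.cluster_subset
  cluster_disjoint := X.cluster_disjoint
  cluster_connected := X.cluster_connected
  A_subset i hi := (Finset.coe_subset.2 (hA i hi).1).trans (X.A_subset i hi)
  B_subset i hi := (Finset.coe_subset.2 (hB i hi).1).trans (X.B_subset i hi)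
  A_disjoint_B i hi := Finset.disjoint_of_subset_left (hA i hi).1
    (Finset.disjoint_of_subset_right (hB i hi).1 (X.A_disjoint_B i hi))
  A_card i hi := (hA i hi).2
  B_card i hi := (hB i hi).2
  degree_first v hv := X.degree_first v ((hA 1 ⟨le_rfl, X.one_le_length⟩).1 hv)
  degree_last v hv := X.degree_last v ((hB ℓ ⟨X.one_le_length, le_rfl⟩).1 hv)
  paths := hP
  paths_disjoint := X.paths_disjoint.mono
    (Set.iUnion₂_mono fun _ _ _ hP => hP.1)
  paths_inner i hi P hP := X.paths_inner i hi P hP.1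

/-- A one-to-one set of paths from `S` to `T`, with rank functions on both sides bounded below
in terms of the cardinality, contains a one-to-one set of paths whose ends are independent on both
sides. -/
lemma exists_indep_ends [DecidableEq V] {Ps : Set (GPath G)} {S T : Finset V}
    (hPs : OneToOnePaths Ps S T) (hS : S.card = w) {r₁ r₂ : Finset V → ℕ}
    (h₁ : IsMatroidRank r₁) (h₂ : IsMatroidRank r₂) {α : ℝ} (hα : 0 < α)
    (hr₁ : ∀ X ⊆ S, ⌈α * w / 4⌉₊ ≤ r₁ X ∨ α * X.card ≤ 2 * r₁ X)
    (hr₂ : ∀ X ⊆ T, ⌈α * w / 4⌉₊ ≤ r₂ X ∨ α * X.card ≤ 2 * r₂ X) :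
    ∃ C ⊆ S, ∃ D ⊆ T, (C.card = ⌈α * w / 4⌉₊ ∧ r₁ C = C.card) ∧
      (D.card = ⌈α * w / 4⌉₊ ∧ r₂ D = D.card) ∧
      OneToOnePaths {P | P ∈ Ps ∧ P.source ∈ C} C D := by
  have hp : ∀ b : S, ∃ P ∈ Ps, P.source = b := fun b => hPs.1.surjOn b.2
  choose p hpPs hps using hp
  have hpinj : ∀ b b', (p b).target = (p b').target → b = b' := fun b b' h => by
    have := hPs.2.injOn (hpPs b) (hpPs b') h
    exact Subtype.ext (by rw [← hps, ← hps, this])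
  let φ : S ↪ V := ⟨fun b => (p b).target, fun b b' => hpinj b b'⟩
  let ψ : S ↪ V := Function.Embedding.subtype _
  have hψ : ∀ I : Finset S, I.map ψ ⊆ S := by
    intro I v hv
    obtain ⟨b, -, rfl⟩ := Finset.mem_map.1 hv
    exact b.2
  have hφ : ∀ I : Finset S, I.map φ ⊆ T := by
    intro I v hv
    obtain ⟨b, -, rfl⟩ := Finset.mem_map.1 hv
    exact hPs.2.mapsTo (hpPs b)
  obtain ⟨I, -, hIc, hI₁, hI₂⟩ := IsMatroidRank.exists_common_indep (Finset.univ : Finset S)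
    (h₁.comap ψ) (h₂.comap φ) ⌈α * w / 4⌉₊ (by
      intro X _
      have a₁ := hr₁ _ (hψ X)
      have a₂ := hr₂ _ (hφ (Finset.univ \ X))
      rcases a₁ with a₁ | a₁
      · omega
      rcases a₂ with a₂ | a₂
      · omega
      rw [Finset.card_map] at a₁ a₂
      have hc : X.card + (Finset.univ \ X).card = w := by
        rw [add_comm, Finset.card_sdiff_add_card_eq_card (Finset.subset_univ X), Finset.card_univ,
          Fintype.card_coe, hS]
      have hc' : (X.card : ℝ) + (Finset.univ \ X).card = w := by exact_mod_cast hc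
      rw [Nat.ceil_le]
      push_cast
      have hw : 0 ≤ α * w := by positivity
      rw [← hc'] at hw ⊢
      linarith)
  refine ⟨I.map ψ, hψ I, I.map φ, hφ I, ⟨by rw [Finset.card_map, hIc], by
    rw [Finset.card_map, hIc]; exact hI₁⟩, ⟨by rw [Finset.card_map, hIc], by
    rw [Finset.card_map, hIc]; exact hI₂⟩, ⟨fun P hP => hP.2,
      hPs.1.injOn.mono fun P hP => hP.1, ?_⟩, ⟨?_, hPs.2.injOn.mono fun P hP => hP.1, ?_⟩⟩
  · intro v hv
    obtain ⟨b, -, rfl⟩ := Finset.mem_map.1 (Finset.mem_coe.1 hv)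
    exact ⟨p b, ⟨hpPs b, by rw [hps]; exact hv⟩, hps b⟩
  · rintro P ⟨hP, hPC⟩
    obtain ⟨b, hb, hbP⟩ := Finset.mem_map.1 hPC
    have : p b = P := hPs.1.injOn (hpPs b) hP (by rw [hps]; exact hbP)
    exact Finset.mem_coe.2 (Finset.mem_map.2 ⟨b, hb, congrArg GPath.target this⟩)
  · intro v hv
    obtain ⟨b, hb, rfl⟩ := Finset.mem_map.1 (Finset.mem_coe.1 hv)
    refine ⟨p b, ⟨hpPs b, ?_⟩, rfl⟩
    rw [hps]
    exact Finset.mem_map_of_mem ψ hb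

/-- An `α`-weak system of width `w` in a graph of maximum degree at most three contains a perfect
system of width `⌈α w / 4⌉` with the same clusters. -/
theorem IsWeak.exists_isPerfect (hV : G.vertexSet.Finite) (hE : G.edgeSet.Finite)
    (hdeg : ∀ v ∈ G.vertexSet, degree G v ≤ 3) {α : ℝ} (hα : 0 < α) (hα' : α ≤ 1)
    {X : PathOfSetsSystem G w ℓ} (hX : X.IsWeak α) :
    ∃ Y : PathOfSetsSystem G ⌈α * w / 4⌉₊ ℓ, Y.IsPerfect ∧ Y.A 1 ⊆ X.A 1 ∧ Y.B ℓ ⊆ X.B ℓ := by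
  classical
  set k := ⌈α * w / 4⌉₊
  let H : ℕ → Graph V E := fun i => G.induce (X.S i)
  let T : ℕ → Finset V := fun i => X.A i ∪ X.B i
  let r : ℕ → Finset V → ℕ := fun i => tangleRank (H i) (T i) k
  have hTV : ∀ i ∈ Set.Icc 1 ℓ, (T i : Set V) ⊆ (H i).vertexSet := by
    intro i hi
    rw [Finset.coe_union]
    exact Set.union_subset (X.A_subset i hi) (X.B_subset i hi)
  have hHE : ∀ i, (H i).edgeSet.Finite := fun i =>
    hE.subset fun e he => by
      obtain ⟨x, y, h⟩ := (H i).exists_isLink_of_mem_edgeSet he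
      exact h.1.edge_mem
  have hHdeg : ∀ i ∈ Set.Icc 1 ℓ, ∀ v ∈ (H i).vertexSet, degree (H i) v ≤ 3 := fun i hi v hv =>
    (degree_induce_le hE _ v).trans (hdeg v (X.cluster_subset i hi hv))
  have hk : ∀ i ∈ Set.Icc 1 ℓ, ∀ s < k, 8 * (s : ℝ) < α * (T i).card := by
    intro i hi s hs
    have h1 : (s : ℝ) < α * w / 4 := Nat.lt_ceil.1 hs
    rw [Finset.card_union_of_disjoint (X.A_disjoint_B i hi), X.A_card i hi, X.B_card i hi]
    push_cast
    linarith
  have hW : ∀ i ∈ Set.Icc 1 ℓ, WellLinked (H i) α (T i) := by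
    intro i hi
    have := hX i hi
    rwa [← Finset.coe_union] at this
  have htan : ∀ i ∈ Set.Icc 1 ℓ, IsTangleSet (H i) (T i) k := fun i hi =>
    (hW i hi).isTangleSet (hV.subset (X.cluster_subset i hi)) (hHE i) (hHdeg i hi) hα hα'
      (hTV i hi) (hk i hi)
  have hr : ∀ i ∈ Set.Icc 1 ℓ, ∀ Y ⊆ T i, k ≤ r i Y ∨ α * Y.card ≤ 2 * r i Y := fun i hi Y hY =>
    (hW i hi).le_tangleRank (hHE i) (hHdeg i hi) hα hα' (htan i hi) (hk i hi) hY
  have hpair : ∀ i, ∃ C D : Finset V, i ∈ Set.Ico 1 ℓ →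
      C ⊆ X.B i ∧ D ⊆ X.A (i + 1) ∧ (C.card = k ∧ r i C = C.card) ∧
      (D.card = k ∧ r (i + 1) D = D.card) ∧
      OneToOnePaths {P | P ∈ X.Ps i ∧ P.source ∈ C} C D := by
    intro i
    by_cases hi : i ∈ Set.Ico 1 ℓ
    swap
    · exact ⟨∅, ∅, fun h => absurd h hi⟩
    have hi₁ : i ∈ Set.Icc 1 ℓ := ⟨hi.1, hi.2.le⟩
    have hi₂ : i + 1 ∈ Set.Icc 1 ℓ := ⟨by omega, hi.2⟩
    obtain ⟨C, hC, D, hD, h⟩ := exists_indep_ends (X.paths i hi) (X.B_card i hi₁)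
      (htan i hi₁).isMatroidRank (htan _ hi₂).isMatroidRank hα
      (fun Y hY => hr i hi₁ Y (hY.trans Finset.subset_union_right))
      (fun Y hY => hr _ hi₂ Y (hY.trans Finset.subset_union_left))
    exact ⟨C, D, fun _ => ⟨hC, hD, h⟩⟩
  -- for an anchor, only one matroid matters: match it to itself by trivial paths
  have hsingle : ∀ i ∈ Set.Icc 1 ℓ, ∀ S ⊆ T i, S.card = w →
      ∃ C ⊆ S, C.card = k ∧ r i C = C.card := by
    intro i hi S hS hSw
    have hSV : ∀ v ∈ S, v ∈ G.vertexSet := fun v hv => X.cluster_subset i hi (hTV i hi (hS hv))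
    let t : S → GPath G := fun v => ⟨v, v, [], IsWalk.nil (hSV v v.2), by simp⟩
    have ht : OneToOnePaths (Set.range t) S S := by
      refine ⟨⟨?_, ?_, fun v hv => ⟨t ⟨v, hv⟩, ⟨_, rfl⟩, rfl⟩⟩,
        ⟨?_, ?_, fun v hv => ⟨t ⟨v, hv⟩, ⟨_, rfl⟩, rfl⟩⟩⟩
      · rintro _ ⟨v, rfl⟩; exact v.2
      · rintro _ ⟨v, rfl⟩ _ ⟨v', rfl⟩ h
        rw [show v = v' from Subtype.ext h]
      · rintro _ ⟨v, rfl⟩; exact v.2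
      · rintro _ ⟨v, rfl⟩ _ ⟨v', rfl⟩ h
        rw [show v = v' from Subtype.ext h]
    obtain ⟨C, hC, -, -, h, -⟩ := exists_indep_ends ht hSw (htan i hi).isMatroidRank
      (htan i hi).isMatroidRank hα (fun Y hY => hr i hi Y (hY.trans hS))
      (fun Y hY => hr i hi Y (hY.trans hS))
    exact ⟨C, hC, h⟩
  have hi1 : 1 ∈ Set.Icc 1 ℓ := ⟨le_rfl, X.one_le_length⟩
  have hiℓ : ℓ ∈ Set.Icc 1 ℓ := ⟨X.one_le_length, le_rfl⟩
  obtain ⟨A₁, hA₁, hA₁'⟩ := hsingle 1 hi1 (X.A 1) Finset.subset_union_left (X.A_card 1 hi1)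
  obtain ⟨Bℓ, hBℓ, hBℓ'⟩ := hsingle ℓ hiℓ (X.B ℓ) Finset.subset_union_right (X.B_card ℓ hiℓ)
  choose C D hCD using hpair
  let A' : ℕ → Finset V := fun i => if i = 1 then A₁ else D (i - 1)
  let B' : ℕ → Finset V := fun i => if i = ℓ then Bℓ else C i
  have hA' : ∀ i ∈ Set.Icc 1 ℓ, A' i ⊆ X.A i ∧ (A' i).card = k ∧ r i (A' i) = (A' i).card := by
    intro i hi
    by_cases h : i = 1
    · subst h
      simp only [A', if_pos]
      exact ⟨hA₁, hA₁'⟩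
    · obtain ⟨j, rfl⟩ : ∃ j, i = j + 1 := ⟨i - 1, by have := hi.1; omega⟩
      obtain ⟨-, h2, -, h3, -⟩ := hCD j ⟨by omega, hi.2⟩
      simp only [A', if_neg h, Nat.add_sub_cancel]
      exact ⟨h2, h3⟩
  have hB' : ∀ i ∈ Set.Icc 1 ℓ, B' i ⊆ X.B i ∧ (B' i).card = k ∧ r i (B' i) = (B' i).card := by
    intro i hi
    by_cases h : i = ℓ
    · subst h
      simp only [B', if_pos]
      exact ⟨hBℓ, hBℓ'⟩
    · obtain ⟨h1, -, h2, -⟩ := hCD i ⟨hi.1, lt_of_le_of_ne hi.2 h⟩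
      simp only [B', if_neg h]
      exact ⟨h1, h2⟩
  refine ⟨X.restrict A' B' (fun i hi => ⟨(hA' i hi).1, (hA' i hi).2.1⟩)
    (fun i hi => ⟨(hB' i hi).1, (hB' i hi).2.1⟩) ?_, ?_, (hA' 1 hi1).1, (hB' ℓ hiℓ).1⟩
  · intro i hi
    have h1 : B' i = C i := if_neg hi.2.ne
    have h2 : A' (i + 1) = D i := if_neg (by have := hi.1; omega)
    rw [h1, h2]
    exact (hCD i hi).2.2.2.2
  · intro i hi
    have hAV : (A' i : Set V) ⊆ (H i).vertexSet :=
      (Finset.coe_subset.2 (hA' i hi).1).trans (X.A_subset i hi)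
    have hBV : (B' i : Set V) ⊆ (H i).vertexSet :=
      (Finset.coe_subset.2 (hB' i hi).1).trans (X.B_subset i hi)
    exact ⟨(htan i hi).nodeWellLinked (hA' i hi).2.2 hAV,
      (htan i hi).nodeWellLinked (hB' i hi).2.2 hBV,
      (htan i hi).nodeLinked (hA' i hi).2.2 (hB' i hi).2.2 hAV hBV⟩

end PathOfSetsSystem

end PoS

theorem mainTheorem10 :
    ∃ c : ℝ, 0 < c ∧
      ∀ (V E : Type*) (G : Graph V E), G.vertexSet.Finite → G.edgeSet.Finite → G.Loopless →
        (∀ v ∈ G.vertexSet, PoS.degree G v ≤ 3) →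
        ∀ (w ℓ : ℕ) (α : ℝ), 0 < α → α ≤ 1 → (∃ k : ℕ, 1 / α = k) →
        ∀ X : PoS.PathOfSetsSystem G w ℓ, X.IsWeak α →
          (∃ Y : PoS.PathOfSetsSystem G ⌈α * w / 4⌉₊ ℓ,
            Y.IsGood ∧ Y.A 1 ⊆ X.A 1 ∧ Y.B ℓ ⊆ X.B ℓ) ∧
          (∃ (w' : ℕ) (Z : PoS.PathOfSetsSystem G w' ℓ),
            α * w / c ≤ w' ∧ Z.IsPerfect ∧ Z.A 1 ⊆ X.A 1 ∧ Z.B ℓ ⊆ X.B ℓ) := by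
  refine ⟨4, by norm_num, ?_⟩
  intro V E G hV hE _ hdeg w ℓ α hα hα' _ X hX
  obtain ⟨Y, hY, hA, hB⟩ := hX.exists_isPerfect hV hE hdeg hα hα'
  exact ⟨⟨Y, hY.isGood, hA, hB⟩, _, Y, Nat.le_ceil _, hY, hA, hB⟩
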